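/- Let $n\ge 1$, let $M_n$ be the $C^*$-algebra of complex $n\times n$ matrices and let $\mathfrak U_n=\mathcal U(n)/(\mathbb T\cdot I)$ be the (compact) quotient topological group of the unitary group of $M_n$ by its scalar matrices. It acts on $M_n$ by $\mathfrak u.A=UAU^{-1}$, where $U$ is any representative of $\mathfrak u$. Let $(X,.)$ be an $n$-space: a locally compact Hausdorff space $X$ with a continuous free action of $\mathfrak U_n$. Let $C^*(X,.)$ be the $C^*$-algebra, with the supremum norm, of all continuous $f:X\to M_n$ vanishing at infinity such that $f(\mathfrak u.x)=\mathfrak u.f(x)$ for all $\mathfrak u\in\mathfrak U_n$, $x\in X$. An $n$-measure on $(X,.)$ is an $n\times n$ matrix $\mu=[\mu_{jk}]$ of complex regular Borel measures on $X$ such that $\mu(\mathfrak u.A)=\mathfrak u.\mu(A)$ for all $\mathfrak u\in\mathfrak U_n$ and all Borel $A\subset X$, where $\mu(A)=[\mu_{jk}(A)]\in M_n$. For a bounded Borel function $f=[f_{jk}]:X\to M_n$ put $\int f\,d\mu=\sum_{j,k}\int_X f_{jk}\,d\mu_{kj}$. Then for every continuous linear functional $\varphi:C^*(X,.)\to\mathbb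 C$ there exists a unique $n$-measure $\mu$ on $(X,.)$ such that $\varphi(f)=\int f\,d\mu$ for every $f\in C^*(X,.)$. -/

import Mathlib

open MeasureTheory
open scoped Matrix.Norms.L2Operator ZeroAtInfty

namespace NSpace

/-- The subgroup `𝕋 · I` of scalar matrices in the unitary group of `M_n`. -/
def scalarUnitary (n : ℕ) : Subgroup (Matrix.unitaryGroup (Fin n) ℂ) where
  carrier := {U | ∃ z : ℂ, ‖z‖ = 1 ∧ (U : Matrix (Fin n) (Fin n) ℂ) = z • 1}
  one_mem' := ⟨1, by simp, by simp⟩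
  mul_mem' := by
    rintro U V ⟨z, hz, hU⟩ ⟨w, hw, hV⟩
    refine ⟨z * w, by simp [hz, hw], ?_⟩
    rw [Submonoid.coe_mul, hU, hV, smul_mul_smul_comm, one_mul]
  inv_mem' := by
    rintro U ⟨z, hz, hU⟩
    refine ⟨star z, by simpa using hz, ?_⟩
    rw [Matrix.UnitaryGroup.inv_val, hU, star_smul, star_one]

instance scalarUnitary_normal (n : ℕ) : (scalarUnitary n).Normal where
  conj_mem := by
    rintro U ⟨z, hz, hU⟩ V
    refine ⟨z, hz, ?_⟩
    have hV : (V : Matrix (Fin n) (Fin n) ℂ) * ((V⁻¹ : Matrix.unitaryGroup (Fin n) ℂ) :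
        Matrix (Fin n) (Fin n) ℂ) = 1 := by
      rw [← Submonoid.coe_mul, mul_inv_cancel, Submonoid.coe_one]
    rw [Submonoid.coe_mul, Submonoid.coe_mul, hU, mul_smul_comm, mul_one, smul_mul_assoc, hV]

/-- The topological group `U(n) / (𝕋 · I)`, with the quotient topology. -/
abbrev PU (n : ℕ) : Type := Matrix.unitaryGroup (Fin n) ℂ ⧸ scalarUnitary n

/-- Conjugation `A ↦ U A U⁻¹` by a unitary matrix, as a homomorphism to permutations of `M_n`. -/
def unitaryConj (n : ℕ) :
    Matrix.unitaryGroup (Fin n) ℂ →* Equiv.Perm (Matrix (Fin n) (Fin n) ℂ) where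
  toFun U :=
    { toFun := fun A => (U : Matrix (Fin n) (Fin n) ℂ) * A *
        ((U⁻¹ : Matrix.unitaryGroup (Fin n) ℂ) : Matrix (Fin n) (Fin n) ℂ)
      invFun := fun A => ((U⁻¹ : Matrix.unitaryGroup (Fin n) ℂ) : Matrix (Fin n) (Fin n) ℂ) * A *
        (U : Matrix (Fin n) (Fin n) ℂ)
      left_inv := fun A => by
        have h : ((U⁻¹ : Matrix.unitaryGroup (Fin n) ℂ) : Matrix (Fin n) (Fin n) ℂ) *
            (U : Matrix (Fin n) (Fin n) ℂ) = 1 := by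
          rw [← Submonoid.coe_mul, inv_mul_cancel, Submonoid.coe_one]
        simp only [mul_assoc, h, mul_one]
        rw [← mul_assoc, h, one_mul]
      right_inv := fun A => by
        have h : (U : Matrix (Fin n) (Fin n) ℂ) *
            ((U⁻¹ : Matrix.unitaryGroup (Fin n) ℂ) : Matrix (Fin n) (Fin n) ℂ) = 1 := by
          rw [← Submonoid.coe_mul, mul_inv_cancel, Submonoid.coe_one]
        simp only [mul_assoc, h, mul_one]
        rw [← mul_assoc, h, one_mul] }
  map_one' := by
    ext1 A
    simp
  map_mul' U V := by
    ext1 A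
    simp only [Equiv.coe_fn_mk, Equiv.Perm.coe_mul, Function.comp_apply, mul_inv_rev,
      Submonoid.coe_mul, mul_assoc]

theorem scalarUnitary_le_ker (n : ℕ) : scalarUnitary n ≤ (unitaryConj n).ker := by
  rintro U ⟨z, hz, hU⟩
  rw [MonoidHom.mem_ker]
  ext1 A
  have h : (U : Matrix (Fin n) (Fin n) ℂ) *
      ((U⁻¹ : Matrix.unitaryGroup (Fin n) ℂ) : Matrix (Fin n) (Fin n) ℂ) = 1 := by
    rw [← Submonoid.coe_mul, mul_inv_cancel, Submonoid.coe_one]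
  have hc : (U : Matrix (Fin n) (Fin n) ℂ) * A = A * (U : Matrix (Fin n) (Fin n) ℂ) := by
    rw [hU, smul_mul_assoc, one_mul, mul_smul_comm, mul_one]
  change (U : Matrix (Fin n) (Fin n) ℂ) * A *
      ((U⁻¹ : Matrix.unitaryGroup (Fin n) ℂ) : Matrix (Fin n) (Fin n) ℂ) = A
  rw [hc, mul_assoc, h, mul_one]

/-- The action `u.A = U A U⁻¹` of `U(n) / (𝕋 · I)` on `M_n`, where `u` is the class of `U`. -/
noncomputable instance matrixAction (n : ℕ) : MulAction (PU n) (Matrix (Fin n) (Fin n) ℂ) :=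
  MulAction.compHom _ (QuotientGroup.lift (scalarUnitary n) (unitaryConj n) (scalarUnitary_le_ker n))

theorem mk_smul {n : ℕ} (U : Matrix.unitaryGroup (Fin n) ℂ) (A : Matrix (Fin n) (Fin n) ℂ) :
    (QuotientGroup.mk U : PU n) • A = (U : Matrix (Fin n) (Fin n) ℂ) * A *
      star (U : Matrix (Fin n) (Fin n) ℂ) := rfl

/-- The `C*`-algebra `C*(X,.)` of all `f ∈ C₀(X, M_n)` with `f(u.x) = u.f(x)`, as a `*`-subalgebra
of `C₀(X, M_n)`; here `M_n` carries its `C*`-norm (the operator norm) and `C₀(X, M_n)` the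
supremum norm. -/
noncomputable def CStar (n : ℕ) (X : Type*) [TopologicalSpace X] [MulAction (PU n) X] :
    NonUnitalStarSubalgebra ℂ C₀(X, Matrix (Fin n) (Fin n) ℂ) where
  carrier := {f | ∀ (u : PU n) (x : X), f (u • x) = u • f x}
  zero_mem' := by
    intro u x
    induction u using QuotientGroup.induction_on with
    | H U => simp [mk_smul]
  add_mem' := by
    intro f g hf hg u x
    have h1 := hf u x
    have h2 := hg u x
    induction u using QuotientGroup.induction_on with
    | H U =>
      rw [mk_smul] at h1 h2 ⊢
      simp [h1, h2, mul_add, add_mul]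
  mul_mem' := by
    intro f g hf hg u x
    have h1 := hf u x
    have h2 := hg u x
    induction u using QuotientGroup.induction_on with
    | H U =>
      rw [mk_smul] at h1 h2 ⊢
      have h : star (U : Matrix (Fin n) (Fin n) ℂ) * (U : Matrix (Fin n) (Fin n) ℂ) = 1 :=
        Unitary.coe_star_mul_self U
      rw [ZeroAtInftyContinuousMap.mul_apply, h1, h2, ZeroAtInftyContinuousMap.mul_apply]
      simp only [mul_assoc]
      rw [← mul_assoc (star (U : Matrix (Fin n) (Fin n) ℂ)) (U : Matrix (Fin n) (Fin n) ℂ),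
        h, one_mul]
  smul_mem' := by
    intro c f hf u x
    have h1 := hf u x
    induction u using QuotientGroup.induction_on with
    | H U =>
      rw [mk_smul] at h1 ⊢
      simp [h1]
  star_mem' := by
    intro f hf u x
    have h1 := hf u x
    induction u using QuotientGroup.induction_on with
    | H U =>
      rw [mk_smul] at h1 ⊢
      rw [ZeroAtInftyContinuousMap.star_apply, h1, ZeroAtInftyContinuousMap.star_apply]
      simp [mul_assoc]

/-- The matrix `μ(A) = [μ_jk(A)]`. -/
noncomputable def evalMatrix {n : ℕ} {X : Type*} [MeasurableSpace X]
    (μ : Matrix (Fin n) (Fin n) (ComplexMeasure X)) (A : Set X) : Matrix (Fin n) (Fin n) ℂ :=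
  Matrix.of fun j k => μ j k A

/-- An `n`-measure: a matrix `μ = [μ_jk]` of regular complex Borel measures (a complex measure being
regular when its total variation is) such that `μ(u.A) = u.μ(A)` for every `u` and Borel `A`. -/
structure IsNMeasure {n : ℕ} {X : Type*} [TopologicalSpace X] [MeasurableSpace X] [BorelSpace X]
    [MulAction (PU n) X] (μ : Matrix (Fin n) (Fin n) (ComplexMeasure X)) : Prop where
  regular : ∀ j k, (μ j k).variation.Regular
  equivariant : ∀ (u : PU n) (A : Set X), MeasurableSet A →
    evalMatrix μ ((fun x => u • x) '' A) = u • evalMatrix μ A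

/-- The integral `∫ f dμ = ∑_{j,k} ∫ f_jk dμ_kj` of a matrix-valued function against a matrix of
complex measures. -/
noncomputable def integral {n : ℕ} {X : Type*} [MeasurableSpace X]
    (f : X → Matrix (Fin n) (Fin n) ℂ) (μ : Matrix (Fin n) (Fin n) (ComplexMeasure X)) : ℂ :=
  ∑ j, ∑ k, (μ k j).integral (fun x => f x j k) (ContinuousLinearMap.mul ℝ ℂ)

end NSpace

/-! Averaging the translates `x ↦ U.F(U⁻¹.x)` over Haar measure on the compact group `U(n)` gives a
contractive projection (`average`) of `C₀(X, M_n)` onto `C*(X,.)`. Composing `φ` with it extends `φ`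
to an invariant functional `ψ` on all of `C₀(X, M_n)`. Entry by entry, Riesz representation
(`exists_complex`) turns `ψ` into a matrix `μ` of regular complex measures, and
`ext_of_integralCLM_eq` says that this matrix is unique.

Equivariance is a fixed-point statement on both sides: `f` lies in `C*(X,.)` iff every translate of
`f` is `f`, and `μ` is equivariant iff `conjMeasure U μ = μ` for all `U`. The two actions are dual
under the trace pairing (`integralCLM_conjMeasure`), so invariance of `ψ` and uniqueness of its
matrix make `μ` an `n`-measure. Conversely, an `n`-measure representing `φ` gives an invariant
functional, which factors through `average`, hence equals `ψ`; so it is `μ`. -/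

/-! ### Regularity by domination, and L¹ approximation of indicators. -/

section RegularMeasure

/-- A measure dominated by a finite inner regular measure is regular. -/
theorem regular_of_le_innerRegular {X : Type*} [TopologicalSpace X] [T2Space X]
    [LocallyCompactSpace X] [MeasurableSpace X] [BorelSpace X] {ν m : Measure X}
    [IsFiniteMeasure m] [m.InnerRegular] (h : ν ≤ m) : ν.Regular := by
  have : IsFiniteMeasure ν := isFiniteMeasure_of_le m h
  have : ν.InnerRegularCompactLTTop := by
    refine ⟨?_⟩
    rintro A ⟨hA, -⟩ r hr
    -- The gap `ν A - r` is the allowed loss: domination carries `m (A \ K) < ν A - r` over to `ν`,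
    -- which forces `ν K > r`.
    obtain ⟨K, hKA, hK, hlt⟩ := hA.exists_isCompact_sdiff_lt (μ := m) (measure_ne_top _ _)
      (tsub_pos_of_lt hr).ne'
    refine ⟨K, hKA, hK, ?_⟩
    have h1 : ν A ≤ ν K + ν (A \ K) := by
      rw [← measure_sdiff_add_inter A hK.measurableSet, add_comm]
      gcongr
      exact Set.inter_subset_right
    have h2 : ν (A \ K) < ν A - r := (h _).trans_lt hlt
    by_contra hcon
    have h3 : ν A < r + (ν A - r) := by
      refine h1.trans_lt (ENNReal.add_lt_add_of_le_of_lt (measure_ne_top _ _)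
        (not_lt.1 hcon) h2)
    rw [add_tsub_cancel_of_le hr.le] at h3
    exact lt_irrefl _ h3
  infer_instance

/-- In a locally compact Hausdorff space, the indicator of a Borel set is approximated in `L¹` of a
finite regular measure by compactly supported continuous functions. -/
theorem exists_hasCompactSupport_lintegral_indicator_sub_le {X : Type*} [TopologicalSpace X]
    [T2Space X] [LocallyCompactSpace X] [MeasurableSpace X] [BorelSpace X] {m : Measure X}
    [IsFiniteMeasure m] [m.Regular] {A : Set X} (hA : MeasurableSet A) {ε : ENNReal}
    (hε : ε ≠ 0) :
    ∃ g : X → ℂ, HasCompactSupport g ∧ ∫⁻ x, ‖A.indicator (fun _ => (1 : ℂ)) x - g x‖ₑ ∂m ≤ ε ∧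
      Continuous g ∧ Integrable g m := by
  have hε2 : ε / 2 ≠ 0 := (ENNReal.half_pos hε).ne'
  obtain ⟨K, hKA, hK, hKlt⟩ := hA.exists_isCompact_sdiff_lt (measure_ne_top m A) hε2
  obtain ⟨U, hAU, hU, -, hUlt⟩ := hA.exists_isOpen_sdiff_lt (measure_ne_top m A) hε2
  obtain ⟨f, hfK, hfU, hfc, hf⟩ := exists_continuous_one_zero_of_isCompact hK
    hU.isClosed_compl (Set.disjoint_compl_right_iff_subset.2 (hKA.trans hAU))
  have hcont : Continuous fun x => (f x : ℂ) := by fun_prop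
  have hcs : HasCompactSupport fun x => (f x : ℂ) := hfc.comp_left (g := Complex.ofReal) rfl
  refine ⟨fun x => (f x : ℂ), hcs, ?_, hcont, hcont.integrable_of_hasCompactSupport hcs⟩
  -- The Urysohn function agrees with the indicator on `K` and off `U`, so the error is at most `1`
  -- and lives on `(U \ A) ∪ (A \ K)`.
  have hle : ∀ x, ‖A.indicator (fun _ => (1 : ℂ)) x - f x‖ₑ ≤
      (U \ A ∪ A \ K).indicator (fun _ => (1 : ENNReal)) x := by
    intro x
    have h01 := hf x
    by_cases hx : x ∈ U \ A ∪ A \ K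
    · rw [Set.indicator_of_mem hx, ← ofReal_norm]
      refine ENNReal.ofReal_le_one.2 ?_
      by_cases hxA : x ∈ A
      · rw [Set.indicator_of_mem hxA, ← Complex.ofReal_one, ← Complex.ofReal_sub,
          Complex.norm_real, Real.norm_eq_abs, abs_le]
        constructor <;> linarith [h01.1, h01.2]
      · rw [Set.indicator_of_notMem hxA, zero_sub, norm_neg, Complex.norm_real, Real.norm_eq_abs,
          abs_le]
        constructor <;> linarith [h01.1, h01.2]
    · rw [Set.indicator_of_notMem hx]
      by_cases hxA : x ∈ A
      · have hxK : x ∈ K := by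
          by_contra h
          exact hx (Or.inr ⟨hxA, h⟩)
        simp [hxA, hfK hxK]
      · have hxU : x ∈ Uᶜ := fun h => hx (Or.inl ⟨h, hxA⟩)
        simp [hxA, hfU hxU]
  refine (lintegral_mono hle).trans ?_
  rw [lintegral_indicator_const ((hU.measurableSet.diff hA).union (hA.diff hK.measurableSet)),
    one_mul]
  refine (measure_union_le _ _).trans ?_
  rw [← ENNReal.add_halves ε]
  exact add_le_add hUlt.le hKlt.le

end RegularMeasure

/-! ### Integration of complex functions against complex measures. -/

namespace ComplexMeasureIntegral

variable {X : Type*} [MeasurableSpace X]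

theorem variation_le_re_add_im (μ : ComplexMeasure X) :
    μ.variation ≤ (ComplexMeasure.re μ).variation + (ComplexMeasure.im μ).variation := by
  refine VectorMeasure.variation_le_of_forall_enorm_le fun E _ => ?_
  calc ‖μ E‖ₑ = ‖((μ E).re : ℂ) + (μ E).im * Complex.I‖ₑ := by rw [Complex.re_add_im]
    _ ≤ ‖((μ E).re : ℂ)‖ₑ + ‖((μ E).im : ℂ) * Complex.I‖ₑ := enorm_add_le _ _
    _ = ‖ComplexMeasure.re μ E‖ₑ + ‖ComplexMeasure.im μ E‖ₑ := by
        simp [enorm, nnnorm, ComplexMeasure.re_apply, ComplexMeasure.im_apply]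
        rfl
    _ ≤ _ := by
        rw [Measure.add_apply]
        gcongr <;> exact VectorMeasure.enorm_measure_le_variation _ _

instance isFiniteMeasure_variation (μ : ComplexMeasure X) : IsFiniteMeasure μ.variation := by
  have h1 : IsFiniteMeasure (ComplexMeasure.re μ).variation := by
    rw [← SignedMeasure.totalVariation_eq_variation]; infer_instance
  have h2 : IsFiniteMeasure (ComplexMeasure.im μ).variation := by
    rw [← SignedMeasure.totalVariation_eq_variation]; infer_instance
  exact isFiniteMeasure_of_le _ (variation_le_re_add_im μ)

theorem finsetSum_measure_apply {ι : Type*} (s : Finset ι) (μ : ι → ComplexMeasure X)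
    (A : Set X) : (∑ i ∈ s, μ i) A = ∑ i ∈ s, μ i A := by
  classical
  induction s using Finset.induction_on with
  | empty => simp
  | insert a s ha ih => rw [Finset.sum_insert ha, Finset.sum_insert ha, ← ih]; rfl

/-- The integral of a complex function against a complex measure. -/
noncomputable abbrev cintegral (f : X → ℂ) (μ : ComplexMeasure X) : ℂ :=
  μ.integral f (ContinuousLinearMap.mul ℝ ℂ)

/-- The pairing `ContinuousLinearMap.mul ℝ ℂ` is only real bilinear by type; complex homogeneity
comes from associativity of multiplication. -/
theorem cintegral_smul (c : ℂ) (f : X → ℂ) (μ : ComplexMeasure X) :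
    cintegral (c • f) μ = c * cintegral f μ := by
  rw [cintegral, VectorMeasure.integral_eq_setToFun, setToFun_smul, smul_eq_mul]
  · rfl
  · intro c s x
    simp only [VectorMeasure.transpose]
    exact mul_assoc c x (μ s)

theorem enorm_cintegral_le (f : X → ℂ) (μ : ComplexMeasure X) :
    ‖cintegral f μ‖ₑ ≤ ∫⁻ x, ‖f x‖ₑ ∂μ.variation := by
  refine VectorMeasure.enorm_integral_le_lintegral_enorm.trans ?_
  have : ‖ContinuousLinearMap.mul ℝ ℂ‖ₑ ≤ 1 := by
    rw [← ofReal_norm]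
    exact ENNReal.ofReal_le_one.2 (ContinuousLinearMap.opNorm_mul_le ℝ ℂ)
  exact mul_le_of_le_one_left zero_le this

/-- Both integrals are `setToFun` of set functions that agree on measurable sets; only the control
measure differs, `μ.variation` against the larger `P`. -/
theorem cintegral_eq_integral_of_real {P : Measure X} [IsFiniteMeasure P] {μ : ComplexMeasure X}
    (h : ∀ s, MeasurableSet s → μ s = (P.real s : ℂ)) {f : X → ℂ} (hf : Integrable f P) :
    cintegral f μ = ∫ x, f x ∂P := by
  have hle : μ.variation ≤ P := by
    refine VectorMeasure.variation_le_of_forall_enorm_le fun E hE => ?_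
    rw [h E hE, ← ofReal_norm, Complex.norm_real, Real.norm_of_nonneg measureReal_nonneg,
      ofReal_measureReal]
  have hT : ∀ s, MeasurableSet s → P s < ⊤ →
      (weightedSMul P : Set X → ℂ →L[ℝ] ℂ) s = μ.transpose (ContinuousLinearMap.mul ℝ ℂ) s := by
    intro s hs _
    ext x; simp [VectorMeasure.transpose, weightedSMul_apply, h s hs, mul_comm]
  have hdom : DominatedFinMeasAdditive P (μ.transpose (ContinuousLinearMap.mul ℝ ℂ)) 1 := by
    refine ⟨fun s t hs ht _ _ hd => 
      cbmApplyMeasure_union μ (ContinuousLinearMap.mul ℝ ℂ) hs ht hd, fun s hs hsf => ?_⟩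
    rw [← hT s hs hsf]
    exact (dominatedFinMeasAdditive_weightedSMul P).2 s hs hsf
  rw [cintegral, VectorMeasure.integral_eq_setToFun, MeasureTheory.integral_eq_setToFun,
    setToFun_congr_left' (dominatedFinMeasAdditive_weightedSMul P) hdom hT f]
  exact (setToFun_congr_measure_of_integrable 1 ENNReal.one_ne_top (by simpa using hle) _ _ _
    hf).symm

theorem cintegral_smul_measure (c : ℂ) (f : X → ℂ) (μ : ComplexMeasure X) :
    cintegral f (c • μ) = c * cintegral f μ := by
  have hv : (c • μ).variation = ‖c‖₊ • μ.variation := by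
    simp [VectorMeasure.variation_smul]
  by_cases hf : Integrable f μ.variation
  swap
  -- Nonintegrable functions have integral `0` by convention, and scaling by `c ≠ 0` does not change
  -- integrability.
  · by_cases hc : c = 0
    · subst hc
      have h0 : (0 : ℂ) • μ = 0 := by ext s; simp
      rw [h0, zero_mul]
      exact VectorMeasure.integral_zero_vectorMeasure
    · have : ¬ Integrable f (c • μ).variation := by
        rw [hv]
        intro h
        apply hf
        have h' := h.smul_measure_nnreal (c := ‖c‖₊⁻¹)
        rwa [smul_smul, inv_mul_cancel₀ (by simpa using hc), one_smul] at h'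
      rw [cintegral, VectorMeasure.integral_undef this, cintegral, VectorMeasure.integral_undef hf,
        mul_zero]
  have key : cintegral f (c • μ) = cintegral (c • f) μ := by
    refine Integrable.induction (μ := μ.variation)
      (P := fun f => cintegral f (c • μ) = cintegral (c • f) μ) ?_ ?_ ?_ ?_ hf
    · intro a s hs _
      have : (c • s.indicator fun _ => a) = s.indicator fun _ : X => c * a := by
        ext x; by_cases hx : x ∈ s <;> simp [hx]
      rw [this, cintegral, cintegral, VectorMeasure.integral_indicator_const _ hs,
        VectorMeasure.integral_indicator_const _ hs]
      simp only [ContinuousLinearMap.mul_apply', FunLike.coe_smul, Pi.smul_apply,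
        smul_eq_mul]
      ring
    · intro f g _ hf hg hPf hPg
      have hf' : Integrable f (c • μ).variation := by rw [hv]; exact hf.smul_measure_nnreal
      have hg' : Integrable g (c • μ).variation := by rw [hv]; exact hg.smul_measure_nnreal
      rw [cintegral, VectorMeasure.integral_add hf' hg', smul_add, cintegral,
        VectorMeasure.integral_add (hf.smul c) (hg.smul c)]
      exact congrArg₂ (· + ·) hPf hPg
    · have e : ∀ f : X →₁[μ.variation] ℂ, cintegral (c • (f : X → ℂ)) μ = c * cintegral f μ :=
        fun f => cintegral_smul c _ _
      simp_rw [e]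
      refine isClosed_eq ?_ (continuous_const.mul VectorMeasure.continuous_integral)
      -- The integral is against `c • μ` while the L¹ space belongs to `μ`; continuity follows
      -- because the variation is multiplied exactly by `‖c‖`.
      refine LipschitzWith.continuous (K := ‖c‖₊) ?_
      refine LipschitzWith.of_dist_le_mul fun f g => ?_
      have hf' : Integrable f (c • μ).variation := by
        rw [hv]; exact (L1.integrable_coeFn f).smul_measure_nnreal
      have hg' : Integrable g (c • μ).variation := by
        rw [hv]; exact (L1.integrable_coeFn g).smul_measure_nnreal
      rw [dist_edist, dist_edist, ← ENNReal.coe_toReal, ← ENNReal.toReal_mul]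
      refine ENNReal.toReal_mono (ENNReal.mul_ne_top ENNReal.coe_ne_top (edist_ne_top _ _)) ?_
      rw [edist_eq_enorm_sub, ← VectorMeasure.integral_sub hf' hg', L1.edist_def]
      refine (enorm_cintegral_le _ _).trans ?_
      rw [hv, lintegral_smul_measure]
      simp [edist_eq_enorm_sub, ENNReal.smul_def]
    · intro f g hfg _ h
      have hfg' : f =ᵐ[(c • μ).variation] g := by
        rw [hv]; exact Measure.ae_smul_measure hfg _
      rw [cintegral, ← VectorMeasure.integral_congr_ae hfg', cintegral,
        ← VectorMeasure.integral_congr_ae (hfg.const_smul c)]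
      exact h
  rw [key, cintegral_smul]

/-- A finite measure as a complex measure. -/
noncomputable def complexOfMeasure (P : Measure X) [IsFiniteMeasure P] : ComplexMeasure X :=
  SignedMeasure.toComplexMeasure P.toSignedMeasure 0

theorem complexOfMeasure_apply (P : Measure X) [IsFiniteMeasure P] {s : Set X}
    (hs : MeasurableSet s) : complexOfMeasure P s = (P.real s : ℂ) := by
  rw [complexOfMeasure, SignedMeasure.toComplexMeasure_apply,
    Measure.toSignedMeasure_apply_measurable hs]
  rfl

theorem variation_complexOfMeasure_le (P : Measure X) [IsFiniteMeasure P] :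
    (complexOfMeasure P).variation ≤ P := by
  refine VectorMeasure.variation_le_of_forall_enorm_le fun E hE => ?_
  rw [complexOfMeasure_apply P hE, ← ofReal_norm, Complex.norm_real,
    Real.norm_of_nonneg measureReal_nonneg, ofReal_measureReal]

variable [TopologicalSpace X] [BorelSpace X]

theorem integrable_zeroAtInfty (f : C₀(X, ℂ)) (P : Measure X) [IsFiniteMeasure P] :
    Integrable f P :=
  f.toBCF.integrable P

/-- The functional on `C₀(X)` given by integration against a complex measure. -/
noncomputable def cintegralCLM (μ : ComplexMeasure X) : C₀(X, ℂ) →L[ℂ] ℂ :=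
  LinearMap.mkContinuous
    { toFun := fun f => cintegral f μ
      map_add' := fun f g => VectorMeasure.integral_add (integrable_zeroAtInfty f _)
        (integrable_zeroAtInfty g _)
      map_smul' := fun c f => cintegral_smul c f μ }
    (μ.variation.real Set.univ) fun f => by
      have h : ‖cintegral f μ‖ₑ ≤ ‖f‖ₑ * μ.variation Set.univ := by
        refine (enorm_cintegral_le _ _).trans ?_
        rw [← lintegral_const]
        refine lintegral_mono fun x => ?_
        rw [← ofReal_norm, ← ofReal_norm]
        exact ENNReal.ofReal_le_ofReal (f.toBCF.norm_coe_le_norm x)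
      have h' := ENNReal.toReal_mono (ENNReal.mul_ne_top enorm_ne_top (measure_ne_top _ _)) h
      rw [ENNReal.toReal_mul, toReal_enorm, toReal_enorm, mul_comm] at h'
      exact h'

@[simp] theorem cintegralCLM_apply (μ : ComplexMeasure X) (f : C₀(X, ℂ)) :
    cintegralCLM μ f = cintegral f μ := rfl

/-- A regular complex measure is determined by its functional on `C₀(X)`. -/
theorem ext_of_cintegral_eq [T2Space X] [LocallyCompactSpace X] {μ ν : ComplexMeasure X}
    (hμ : μ.variation.Regular) (hν : ν.variation.Regular)
    (h : ∀ f : C₀(X, ℂ), cintegral f μ = cintegral f ν) : μ = ν := by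
  -- With the sum of the variations as reference measure, a single `g` approximates the indicator
  -- for `μ` and `ν` at once.
  have hreg : (μ.variation + ν.variation).Regular := regular_of_le_innerRegular le_rfl
  refine VectorMeasure.ext fun A hA => ?_
  have hint : Integrable (A.indicator fun _ => (1 : ℂ)) (μ.variation + ν.variation) :=
    (integrable_const 1).indicator hA
  refine eq_of_forall_dist_le fun ε hε => ?_
  obtain ⟨g, hgc, hg, hgcont, hgint⟩ := exists_hasCompactSupport_lintegral_indicator_sub_le
    (m := μ.variation + ν.variation) hA (ε := ENNReal.ofReal ε) (by simpa using hε)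
  have e1 : cintegral (A.indicator fun _ => (1 : ℂ)) μ = μ A := by
    rw [cintegral, VectorMeasure.integral_indicator_const _ hA]; simp
  have e2 : cintegral (A.indicator fun _ => (1 : ℂ)) ν = ν A := by
    rw [cintegral, VectorMeasure.integral_indicator_const _ hA]; simp
  have e3 : cintegral g μ = cintegral g ν :=
    h ⟨⟨g, hgcont⟩, hgc.is_zero_at_infty⟩
  have b1 : edist (μ A) (cintegral g μ) ≤
      ∫⁻ x, ‖A.indicator (fun _ => (1 : ℂ)) x - g x‖ₑ ∂μ.variation := by
    rw [← e1, edist_eq_enorm_sub, ← VectorMeasure.integral_sub hint.left_of_add_measure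
      hgint.left_of_add_measure]
    exact enorm_cintegral_le _ _
  have b2 : edist (cintegral g μ) (ν A) ≤
      ∫⁻ x, ‖A.indicator (fun _ => (1 : ℂ)) x - g x‖ₑ ∂ν.variation := by
    rw [← e2, e3, edist_comm, edist_eq_enorm_sub,
      ← VectorMeasure.integral_sub hint.right_of_add_measure hgint.right_of_add_measure]
    exact enorm_cintegral_le _ _
  rw [lintegral_add_measure] at hg
  have b3 : edist (μ A) (ν A) ≤ ENNReal.ofReal ε :=
    (edist_triangle _ _ _).trans ((add_le_add b1 b2).trans hg)
  rwa [edist_dist, ENNReal.ofReal_le_ofReal_iff hε.le] at b3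

/-- Variation is subadditive, so the sum of the variations is a dominating finite inner regular
measure. -/
theorem regular_variation_sum [T2Space X] [LocallyCompactSpace X] {ι : Type*} (s : Finset ι) {μ : ι → ComplexMeasure X}
    (h : ∀ i, (μ i).variation.Regular) : (∑ i ∈ s, μ i).variation.Regular := by
  have hm : IsFiniteMeasure (∑ i ∈ s, (μ i).variation) := by
    refine ⟨?_⟩
    rw [Measure.finsetSum_apply]
    exact ENNReal.sum_lt_top.2 fun i _ => measure_lt_top _ _
  have hi : ∀ i, (μ i).variation.InnerRegular := fun i => inferInstance
  exact regular_of_le_innerRegular (VectorMeasure.variation_finsetSum_le s μ)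

omit [BorelSpace X] in
theorem regular_variation_smul (c : ℂ) {μ : ComplexMeasure X} (h : μ.variation.Regular) :
    (c • μ).variation.Regular := by
  rw [VectorMeasure.variation_smul]
  infer_instance

theorem regular_variation_map (g : X ≃ₜ X) {μ : ComplexMeasure X} (h : μ.variation.Regular) :
    (μ.map g).variation.Regular := by
  rw [g.measurableEmbedding.variation_map]
  exact Measure.Regular.map g

end ComplexMeasureIntegral

/-! ### Riesz representation on `C₀(X)` through the positive part of a functional. -/

namespace RieszC0

open scoped CompactlySupported NNReal

variable {X : Type*} [TopologicalSpace X]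

theorem norm_le_of_forall {E : Type*} [NormedAddCommGroup E] (f : C₀(X, E)) {C : ℝ} (hC : 0 ≤ C)
    (h : ∀ x, ‖f x‖ ≤ C) : ‖f‖ ≤ C := by
  rw [← ZeroAtInftyContinuousMap.norm_toBCF_eq_norm]
  exact (BoundedContinuousFunction.norm_le hC).2 h

theorem norm_apply_le {E : Type*} [NormedAddCommGroup E] (f : C₀(X, E)) (x : X) :
    ‖f x‖ ≤ ‖f‖ := by
  rw [← ZeroAtInftyContinuousMap.norm_toBCF_eq_norm]
  exact f.toBCF.norm_coe_le_norm x

/-- Composition of a `C₀` function with a continuous real-linear map. -/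
noncomputable def postcomp {𝕜 E F : Type*} [RCLike 𝕜] [NormedAddCommGroup E] [NormedSpace 𝕜 E]
    [NormedAddCommGroup F] [NormedSpace 𝕜 F] (T : E →L[𝕜] F) : C₀(X, E) →L[𝕜] C₀(X, F) :=
  LinearMap.mkContinuous
    { toFun := fun f => ⟨⟨fun x => T (f x), by fun_prop⟩, by
        have := (T.continuous.tendsto 0).comp f.zero_at_infty'
        rwa [map_zero] at this⟩
      map_add' := fun f g => by ext x; exact map_add T _ _
      map_smul' := fun c f => by ext x; exact map_smul T _ _ }
    ‖T‖ fun f => norm_le_of_forall _ (by positivity) fun x =>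
      (T.le_opNorm _).trans (mul_le_mul_of_nonneg_left (norm_apply_le f x) (norm_nonneg _))

@[simp] theorem postcomp_apply {𝕜 E F : Type*} [RCLike 𝕜] [NormedAddCommGroup E]
    [NormedSpace 𝕜 E] [NormedAddCommGroup F] [NormedSpace 𝕜 F] (T : E →L[𝕜] F) (f : C₀(X, E))
    (x : X) : postcomp T f x = T (f x) := rfl

/-- A compactly supported `ℝ≥0`-valued function as an element of `C₀(X, ℝ)`. -/
def toC0 (f : C_c(X, ℝ≥0)) : C₀(X, ℝ) :=
  ⟨⟨fun x => (f x : ℝ), by fun_prop⟩,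
    (f.hasCompactSupport.comp_left (g := NNReal.toReal) rfl).is_zero_at_infty⟩

@[simp] theorem toC0_apply (f : C_c(X, ℝ≥0)) (x : X) : toC0 f x = f x := rfl

/-- The functions `h ∈ C₀(X, ℝ)` with `0 ≤ h ≤ f`. -/
def below (f : C_c(X, ℝ≥0)) : Set C₀(X, ℝ) := {h | ∀ x, 0 ≤ h x ∧ h x ≤ f x}

theorem zero_mem_below (f : C_c(X, ℝ≥0)) : (0 : C₀(X, ℝ)) ∈ below f := fun x => by simp

theorem abs_apply_le_of_mem_below (L : C₀(X, ℝ) →L[ℝ] ℝ) {f : C_c(X, ℝ≥0)} {h : C₀(X, ℝ)}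
    (hh : h ∈ below f) {C : ℝ} (hC : 0 ≤ C) (hf : ∀ x, (f x : ℝ) ≤ C) : |L h| ≤ ‖L‖ * C := by
  refine (L.le_opNorm h).trans (mul_le_mul_of_nonneg_left ?_ (norm_nonneg _))
  refine norm_le_of_forall h hC fun x => ?_
  rw [Real.norm_of_nonneg (hh x).1]
  exact (hh x).2.trans (hf x)

theorem bddAbove_below (L : C₀(X, ℝ) →L[ℝ] ℝ) (f : C_c(X, ℝ≥0)) : BddAbove (L '' below f) := by
  refine ⟨‖L‖ * ‖toC0 f‖, ?_⟩
  rintro _ ⟨h, hh, rfl⟩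
  refine (le_abs_self _).trans (abs_apply_le_of_mem_below L hh (norm_nonneg _) fun x => ?_)
  exact (le_abs_self _).trans (norm_apply_le (toC0 f) x)

/-- The value at `f` of the positive part of a bounded functional. -/
noncomputable def posVal (L : C₀(X, ℝ) →L[ℝ] ℝ) (f : C_c(X, ℝ≥0)) : ℝ := sSup (L '' below f)

theorem le_posVal (L : C₀(X, ℝ) →L[ℝ] ℝ) {f : C_c(X, ℝ≥0)} {h : C₀(X, ℝ)} (hh : h ∈ below f) :
    L h ≤ posVal L f :=
  le_csSup (bddAbove_below L f) ⟨h, hh, rfl⟩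

theorem posVal_le (L : C₀(X, ℝ) →L[ℝ] ℝ) {f : C_c(X, ℝ≥0)} {c : ℝ}
    (h : ∀ g ∈ below f, L g ≤ c) : posVal L f ≤ c := by
  refine csSup_le ⟨_, 0, zero_mem_below f, rfl⟩ ?_
  rintro _ ⟨g, hg, rfl⟩
  exact h g hg

theorem posVal_nonneg (L : C₀(X, ℝ) →L[ℝ] ℝ) (f : C_c(X, ℝ≥0)) : 0 ≤ posVal L f := by
  simpa using le_posVal L (zero_mem_below f)

theorem posVal_add (L : C₀(X, ℝ) →L[ℝ] ℝ) (f g : C_c(X, ℝ≥0)) :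
    posVal L (f + g) = posVal L f + posVal L g := by
  refine le_antisymm (posVal_le L fun h hh => ?_) ?_
  -- Riesz decomposition: `0 ≤ h ≤ f + g` splits as `min h f`, below `f`, plus a remainder below
  -- `g`.
  · let h₁ : C₀(X, ℝ) := ⟨⟨fun x => min (h x) (f x), by fun_prop⟩, by
      have := (h.zero_at_infty').min (toC0 f).zero_at_infty'
      simpa using! this⟩
    have e₁ : ∀ x, h₁ x = min (h x) (f x) := fun _ => rfl
    have m₁ : h₁ ∈ below f := fun x => by
      rw [e₁]; exact ⟨le_min (hh x).1 (f x).2, min_le_right _ _⟩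
    have m₂ : h - h₁ ∈ below g := fun x => by
      have h1 := hh x
      rw [CompactlySupportedContinuousMap.add_apply, NNReal.coe_add] at h1
      have h3 : (0 : ℝ) ≤ g x := (g x).2
      rw [ZeroAtInftyContinuousMap.sub_apply, e₁]
      rcases min_cases (h x) (f x : ℝ) with ⟨h2, _⟩ | ⟨h2, _⟩ <;> rw [h2] <;>
        constructor <;> linarith
    have : L h = L h₁ + L (h - h₁) := by rw [← map_add]; congr 1; abel
    rw [this]
    exact add_le_add (le_posVal L m₁) (le_posVal L m₂)
  · have key : ∀ h₁ ∈ below f, ∀ h₂ ∈ below g, L h₁ + L h₂ ≤ posVal L (f + g) := by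
      intro h₁ m₁ h₂ m₂
      rw [← map_add]
      refine le_posVal L fun x => ?_
      rw [ZeroAtInftyContinuousMap.add_apply, CompactlySupportedContinuousMap.add_apply,
        NNReal.coe_add]
      exact ⟨add_nonneg (m₁ x).1 (m₂ x).1, add_le_add (m₁ x).2 (m₂ x).2⟩
    rw [← le_sub_iff_add_le]
    refine posVal_le L fun h₁ m₁ => ?_
    rw [le_sub_comm]
    refine posVal_le L fun h₂ m₂ => ?_
    linarith [key h₁ m₁ h₂ m₂]

/-- This inequality suffices for homogeneity: applied to `c⁻¹` and `c • f` it gives the reverse one.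
-/
theorem posVal_smul_le (L : C₀(X, ℝ) →L[ℝ] ℝ) {c : ℝ≥0} (hc : c ≠ 0) (f : C_c(X, ℝ≥0)) :
    c * posVal L f ≤ posVal L (c • f) := by
  have hc' : (0 : ℝ) < c := by exact_mod_cast pos_iff_ne_zero.2 hc
  rw [← le_div_iff₀' hc']
  refine posVal_le L fun h hh => ?_
  rw [le_div_iff₀' hc', ← smul_eq_mul, ← map_smul]
  refine le_posVal L fun x => ?_
  rw [ZeroAtInftyContinuousMap.smul_apply, CompactlySupportedContinuousMap.smul_apply,
    smul_eq_mul, smul_eq_mul, NNReal.coe_mul]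
  exact ⟨mul_nonneg hc'.le (hh x).1, mul_le_mul_of_nonneg_left (hh x).2 hc'.le⟩

theorem posVal_smul (L : C₀(X, ℝ) →L[ℝ] ℝ) (c : ℝ≥0) (f : C_c(X, ℝ≥0)) :
    posVal L (c • f) = c * posVal L f := by
  rcases eq_or_ne c 0 with rfl | hc
  · have h := posVal_add L 0 0
    rw [add_zero] at h
    rw [zero_smul, NNReal.coe_zero, zero_mul]
    linarith
  · refine le_antisymm ?_ (posVal_smul_le L hc f)
    have h := posVal_smul_le L (inv_ne_zero hc) (c • f)
    rw [smul_smul, inv_mul_cancel₀ hc, one_smul, NNReal.coe_inv] at h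
    have hc' : (0 : ℝ) < c := by exact_mod_cast pos_iff_ne_zero.2 hc
    rwa [inv_mul_le_iff₀ hc'] at h

/-- The positive part of a bounded functional, as a linear functional on `C_c(X, ℝ≥0)`. -/
noncomputable def posPart (L : C₀(X, ℝ) →L[ℝ] ℝ) : C_c(X, ℝ≥0) →ₗ[ℝ≥0] ℝ≥0 where
  toFun f := ⟨posVal L f, posVal_nonneg L f⟩
  map_add' f g := NNReal.eq (posVal_add L f g)
  map_smul' c f := NNReal.eq (posVal_smul L c f)

@[simp] theorem coe_posPart (L : C₀(X, ℝ) →L[ℝ] ℝ) (f : C_c(X, ℝ≥0)) :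
    (posPart L f : ℝ) = posVal L f := rfl

/-- The reflection `h ↦ f - h` preserves the functions between `0` and `f`. This is the Jordan
decomposition of `L` into its positive part minus that of `-L`. -/
theorem posVal_neg (L : C₀(X, ℝ) →L[ℝ] ℝ) (f : C_c(X, ℝ≥0)) :
    posVal L f = L (toC0 f) + posVal (-L) f := by
  have hsub : ∀ h ∈ below f, toC0 f - h ∈ below f := fun h hh x => by
    have := hh x
    rw [ZeroAtInftyContinuousMap.sub_apply, toC0_apply]
    constructor <;> linarith
  have key : ∀ (M : C₀(X, ℝ) →L[ℝ] ℝ), posVal M f ≤ M (toC0 f) + posVal (-M) f := fun M => by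
    refine posVal_le M fun h hh => ?_
    have := le_posVal (-M) (hsub h hh)
    rw [neg_apply, map_sub] at this
    linarith
  refine le_antisymm (key L) ?_
  have := key (-L)
  have hL : -(-L) = L := by ext f; simp
  rw [hL, neg_apply] at this
  linarith

variable [MeasurableSpace X] [BorelSpace X]

theorem integrable_real (f : C₀(X, ℝ)) (P : Measure X) [IsFiniteMeasure P] : Integrable f P :=
  f.toBCF.integrable P

variable [T2Space X] [LocallyCompactSpace X]

instance isFiniteMeasure_rieszMeasure_posPart (L : C₀(X, ℝ) →L[ℝ] ℝ) :
    IsFiniteMeasure (NNRealRMK.rieszMeasure (posPart L)) := by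
  refine ⟨lt_of_le_of_lt (b := ENNReal.ofReal ‖L‖) ?_ ENNReal.ofReal_lt_top⟩
  -- By inner regularity it is enough to bound the mass of each compact set by `‖L‖`, testing
  -- against a Urysohn function with values in `[0, 1]`.
  rw [isOpen_univ.measure_eq_iSup_isCompact]
  refine iSup₂_le fun K _ => iSup_le fun hK => ?_
  obtain ⟨f, hfK, -, hfc, hf⟩ := exists_continuous_one_zero_of_isCompact hK isClosed_empty
    (Set.disjoint_empty K)
  let g : C_c(X, ℝ≥0) := ⟨⟨fun x => (f x).toNNReal, by fun_prop⟩,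
    hfc.comp_left (g := Real.toNNReal) Real.toNNReal_zero⟩
  have hg : ∀ x, g x = (f x).toNNReal := fun _ => rfl
  calc NNRealRMK.rieszMeasure (posPart L) K
      = ∫⁻ x, K.indicator (fun _ => 1) x ∂(NNRealRMK.rieszMeasure (posPart L)) := by
        rw [lintegral_indicator_const hK.measurableSet, one_mul]
    _ ≤ ∫⁻ x, g x ∂(NNRealRMK.rieszMeasure (posPart L)) := by
        refine lintegral_mono fun x => ?_
        by_cases hx : x ∈ K
        · simp [hx, hg, hfK hx]
        · simp [hx]
    _ = posPart L g := NNRealRMK.lintegral_rieszMeasure _ g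
    _ ≤ ENNReal.ofReal ‖L‖ := by
        rw [← ENNReal.ofReal_coe_nnreal, coe_posPart]
        refine ENNReal.ofReal_le_ofReal (posVal_le L fun h hh => ?_)
        refine (le_abs_self _).trans ?_
        have := abs_apply_le_of_mem_below L hh zero_le_one fun x => by
          rw [hg, Real.coe_toNNReal _ (hf x).1]; exact (hf x).2
        rwa [mul_one] at this

/-- Soft thresholding of a nonnegative function of `C₀(X, ℝ)`, which has compact support. -/
noncomputable def threshold (f : C₀(X, ℝ)) {ε : ℝ} (hε : 0 < ε) : C_c(X, ℝ≥0) :=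
  ⟨⟨fun x => (f x - ε).toNNReal, by fun_prop⟩, by
    have h : ∀ᶠ x in Filter.cocompact X, f x < ε :=
      f.zero_at_infty'.eventually (gt_mem_nhds hε)
    obtain ⟨K, hK, hKs⟩ := Filter.mem_cocompact.1 h
    refine HasCompactSupport.intro hK fun x hx => ?_
    have : f x < ε := hKs hx
    exact Real.toNNReal_of_nonpos (by linarith)⟩

/-- **Riesz representation** for bounded real functionals on `C₀(X, ℝ)`. -/
theorem exists_real (L : C₀(X, ℝ) →L[ℝ] ℝ) : ∃ P N : Measure X, IsFiniteMeasure P ∧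
    IsFiniteMeasure N ∧ P.Regular ∧ N.Regular ∧
      ∀ f : C₀(X, ℝ), L f = ∫ x, f x ∂P - ∫ x, f x ∂N := by
  refine ⟨NNRealRMK.rieszMeasure (posPart L), NNRealRMK.rieszMeasure (posPart (-L)),
    inferInstance, inferInstance, inferInstance, inferInstance, ?_⟩
  set P := NNRealRMK.rieszMeasure (posPart L)
  set N := NNRealRMK.rieszMeasure (posPart (-L))
  have hcc : ∀ f : C_c(X, ℝ≥0), L (toC0 f) = ∫ x, (f x : ℝ) ∂P - ∫ x, (f x : ℝ) ∂N := by
    intro f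
    rw [NNRealRMK.integral_rieszMeasure, NNRealRMK.integral_rieszMeasure, coe_posPart,
      coe_posPart, posVal_neg L f]
    ring
  have hnonneg : ∀ f : C₀(X, ℝ), (∀ x, 0 ≤ f x) → L f = ∫ x, f x ∂P - ∫ x, f x ∂N := by
    intro f hf
    -- Soft thresholding moves `f` by at most `ε` uniformly, and both sides of the identity are
    -- sup-norm continuous because `P` and `N` are finite.
    have hbound : ∀ ε : ℝ, 0 < ε →
        |L f - (∫ x, f x ∂P - ∫ x, f x ∂N)| ≤ (‖L‖ + P.real Set.univ + N.real Set.univ) * ε := by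
      intro ε hε
      set g := threshold f hε
      have hgx : ∀ x, ‖(f - toC0 g) x‖ ≤ ε := by
        intro x
        have hx := hf x
        have e : (f - toC0 g) x = f x - max (f x - ε) 0 := rfl
        rw [e, Real.norm_eq_abs, abs_le]
        rcases max_cases (f x - ε) 0 with ⟨h2, _⟩ | ⟨h2, _⟩ <;> rw [h2] <;>
          constructor <;> linarith
      have hL : |L (f - toC0 g)| ≤ ‖L‖ * ε :=
        (L.le_opNorm _).trans (mul_le_mul_of_nonneg_left
          (norm_le_of_forall _ hε.le hgx) (norm_nonneg _))
      have hint : ∀ Q : Measure X, [IsFiniteMeasure Q] →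
          |∫ x, f x ∂Q - ∫ x, (g x : ℝ) ∂Q| ≤ ε * Q.real Set.univ := by
        intro Q _
        have := norm_integral_le_of_norm_le_const (μ := Q) (Filter.Eventually.of_forall hgx)
        have e : ∫ x, (f - toC0 g) x ∂Q = ∫ x, f x ∂Q - ∫ x, (g x : ℝ) ∂Q :=
          integral_sub (integrable_real f Q) (integrable_real (toC0 g) Q)
        rwa [e] at this
      have h1 := hint P
      have h2 := hint N
      have h3 := hcc g
      rw [map_sub] at hL
      rw [abs_le] at *
      constructor <;> nlinarith [hL.1, hL.2, h1.1, h1.2, h2.1, h2.2]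
    set C := ‖L‖ + P.real Set.univ + N.real Set.univ with hC
    have hC0 : 0 ≤ C := by positivity
    have hzero : |L f - (∫ x, f x ∂P - ∫ x, f x ∂N)| ≤ 0 := by
      refine le_of_forall_pos_le_add fun δ hδ => ?_
      -- Dividing by `C + 1` rather than `C` covers `C = 0`.
      refine (hbound (δ / (C + 1)) (by positivity)).trans ?_
      rw [zero_add, mul_div_assoc', div_le_iff₀ (by positivity)]
      nlinarith
    exact sub_eq_zero.1 (abs_eq_zero.1 (le_antisymm hzero (abs_nonneg _)))
  intro f
  have hz := f.zero_at_infty'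
  let fp : C₀(X, ℝ) := ⟨⟨fun x => max (f x) 0, by fun_prop⟩, by
    simpa using! hz.max (tendsto_const_nhds (x := (0 : ℝ)))⟩
  let fm : C₀(X, ℝ) := ⟨⟨fun x => max (-f x) 0, by fun_prop⟩, by
    simpa using! hz.neg.max (tendsto_const_nhds (x := (0 : ℝ)))⟩
  have hfx : ∀ x, f x = fp x - fm x := fun x => by
    have e1 : fp x = max (f x) 0 := rfl
    have e2 : fm x = max (-f x) 0 := rfl
    rw [e1, e2]
    rcases max_cases (f x) 0 with ⟨h2, _⟩ | ⟨h2, _⟩ <;>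
      rcases max_cases (-f x) 0 with ⟨h3, _⟩ | ⟨h3, _⟩ <;> rw [h2, h3] <;> linarith
  have hf : f = fp - fm := by ext x; exact hfx x
  have hp := hnonneg fp fun x => le_max_right _ _
  have hm := hnonneg fm fun x => le_max_right _ _
  rw [integral_congr_ae (Filter.Eventually.of_forall hfx),
    integral_congr_ae (μ := N) (Filter.Eventually.of_forall hfx),
    integral_sub (integrable_real fp P) (integrable_real fm P),
    integral_sub (integrable_real fp N) (integrable_real fm N), hf, map_sub, hp, hm]
  ring

open ComplexMeasureIntegral

/-- **Riesz representation** for bounded complex functionals on `C₀(X, ℂ)`. -/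
theorem exists_complex (Λ : C₀(X, ℂ) →L[ℂ] ℂ) : ∃ μ : ComplexMeasure X, μ.variation.Regular ∧
    ∀ f : C₀(X, ℂ), Λ f = cintegral f μ := by
  let ι : C₀(X, ℝ) →L[ℝ] C₀(X, ℂ) := postcomp Complex.ofRealCLM
  let ΛR : C₀(X, ℂ) →L[ℝ] ℂ := Λ.restrictScalars ℝ
  obtain ⟨P, N, _, _, hP, hN, hR⟩ := exists_real (Complex.reCLM.comp (ΛR.comp ι))
  obtain ⟨P', N', _, _, hP', hN', hI⟩ := exists_real (Complex.imCLM.comp (ΛR.comp ι))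
  let κ : ComplexMeasure X := complexOfMeasure P - complexOfMeasure N
  let κ' : ComplexMeasure X := complexOfMeasure P' - complexOfMeasure N'
  -- By complex linearity it suffices to represent `Λ` on real functions, where its real and
  -- imaginary parts are bounded real functionals.
  have hreal : ∀ g : C₀(X, ℝ), Λ (ι g) = cintegral (ι g) (κ + Complex.I • κ') := by
    intro g
    have hint : ∀ μ : ComplexMeasure X, Integrable (ι g) μ.variation :=
      fun μ => integrable_zeroAtInfty _ _
    have e : ∀ Q : Measure X, [IsFiniteMeasure Q] →
        cintegral (ι g) (complexOfMeasure Q) = ((∫ x, g x ∂Q : ℝ) : ℂ) := by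
      intro Q _
      rw [cintegral_eq_integral_of_real (fun s hs => complexOfMeasure_apply Q hs)
        (integrable_zeroAtInfty _ _)]
      exact integral_ofReal
    have e1 : cintegral (ι g) κ = ((Λ (ι g)).re : ℂ) := by
      have h := hR g
      rw [cintegral, VectorMeasure.integral_sub_vectorMeasure (hint _) (hint _)]
      refine (congrArg₂ (· - ·) (e P) (e N)).trans ?_
      rw [← Complex.ofReal_sub, ← h]
      rfl
    have e2 : cintegral (ι g) κ' = ((Λ (ι g)).im : ℂ) := by
      have h := hI g
      rw [cintegral, VectorMeasure.integral_sub_vectorMeasure (hint _) (hint _)]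
      refine (congrArg₂ (· - ·) (e P') (e N')).trans ?_
      rw [← Complex.ofReal_sub, ← h]
      rfl
    have e3 : cintegral (ι g) (κ + Complex.I • κ') =
        cintegral (ι g) κ + cintegral (ι g) (Complex.I • κ') :=
      VectorMeasure.integral_add_vectorMeasure (hint _) (hint _)
    rw [e3, cintegral_smul_measure, e1, e2, mul_comm, Complex.re_add_im]
  refine ⟨κ + Complex.I • κ', ?_, fun f => ?_⟩
  · refine regular_of_le_innerRegular (m := (P + N) + (P' + N')) ?_
    refine VectorMeasure.variation_add_le.trans (add_le_add ?_ ?_)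
    · exact VectorMeasure.variation_sub_le.trans (add_le_add (variation_complexOfMeasure_le P)
        (variation_complexOfMeasure_le N))
    · rw [VectorMeasure.variation_smul]
      rw [show ‖Complex.I‖₊ = 1 from NNReal.eq Complex.norm_I, one_smul]
      exact VectorMeasure.variation_sub_le.trans (add_le_add (variation_complexOfMeasure_le P')
        (variation_complexOfMeasure_le N'))
  · let fr : C₀(X, ℝ) := postcomp Complex.reCLM ((f : C₀(X, ℂ)))
    let fi : C₀(X, ℝ) := postcomp Complex.imCLM ((f : C₀(X, ℂ)))
    have hf : f = ι fr + Complex.I • ι fi := by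
      ext x
      change f x = ((f x).re : ℂ) + Complex.I * ((f x).im : ℂ)
      rw [mul_comm, Complex.re_add_im]
    have h1 := hreal fr
    have h2 := hreal fi
    rw [← cintegralCLM_apply] at h1 h2 ⊢
    rw [hf, map_add, map_smul, map_add, map_smul, h1, h2]

end RieszC0

/-! ### Haar averaging over the unitary group. -/

namespace NSpace

open RieszC0 ComplexMeasureIntegral Topology

instance compactSpace_unitaryGroup (n : ℕ) : CompactSpace (Matrix.unitaryGroup (Fin n) ℂ) := by
  have : ProperSpace (Matrix (Fin n) (Fin n) ℂ) := FiniteDimensional.proper ℂ _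
  refine isCompact_iff_compactSpace.1 (Metric.isCompact_of_isClosed_isBounded isClosed_unitary ?_)
  refine (Metric.isBounded_closedBall (x := (0 : Matrix (Fin n) (Fin n) ℂ))
    (r := ‖(1 : Matrix (Fin n) (Fin n) ℂ)‖)).subset fun U hU => ?_
  rw [mem_closedBall_zero_iff]
  have := CStarRing.norm_mem_unitary_mul (1 : Matrix (Fin n) (Fin n) ℂ) hU
  rw [mul_one] at this
  exact this.le

noncomputable instance measurableSpace_unitaryGroup (n : ℕ) :
    MeasurableSpace (Matrix.unitaryGroup (Fin n) ℂ) := borel _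

instance borelSpace_unitaryGroup (n : ℕ) : BorelSpace (Matrix.unitaryGroup (Fin n) ℂ) := ⟨rfl⟩

/-- The normalized Haar measure of the unitary group. -/
noncomputable def haarProb (n : ℕ) : Measure (Matrix.unitaryGroup (Fin n) ℂ) :=
  Measure.haarMeasure ⊤

instance isHaarMeasure_haarProb (n : ℕ) : (haarProb n).IsHaarMeasure :=
  Measure.isHaarMeasure_haarMeasure _

instance isProbabilityMeasure_haarProb (n : ℕ) : IsProbabilityMeasure (haarProb n) :=
  ⟨Measure.haarMeasure_self⟩

/-- A right translate of Haar measure is again a Haar probability measure, so uniqueness gives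
unimodularity. -/
instance isMulRightInvariant_haarProb (n : ℕ) : (haarProb n).IsMulRightInvariant := by
  refine ⟨fun V => ?_⟩
  have : IsProbabilityMeasure ((haarProb n).map (· * V)) :=
    Measure.isProbabilityMeasure_map (measurable_mul_const V).aemeasurable
  exact Measure.isHaarMeasure_eq_of_isProbabilityMeasure _ _

/-- Conjugation by a unitary, as a continuous linear map. -/
noncomputable def conjCLM {n : ℕ} (U : Matrix.unitaryGroup (Fin n) ℂ) :
    Matrix (Fin n) (Fin n) ℂ →L[ℂ] Matrix (Fin n) (Fin n) ℂ :=
  LinearMap.mkContinuous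
    { toFun := fun A => (U : Matrix (Fin n) (Fin n) ℂ) * A * star (U : Matrix (Fin n) (Fin n) ℂ)
      map_add' := fun A B => by rw [mul_add, add_mul]
      map_smul' := fun c A => by simp }
    1 fun A => by
      have h1 := CStarRing.norm_mul_mem_unitary ((U : Matrix (Fin n) (Fin n) ℂ) * A)
        (Unitary.star_mem U.2)
      have h2 := CStarRing.norm_mem_unitary_mul A U.2
      rw [one_mul]
      exact (h1.trans h2).le

theorem norm_conjCLM_apply {n : ℕ} (U : Matrix.unitaryGroup (Fin n) ℂ)
    (A : Matrix (Fin n) (Fin n) ℂ) : ‖conjCLM U A‖ = ‖A‖ :=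
  (CStarRing.norm_mul_mem_unitary ((U : Matrix (Fin n) (Fin n) ℂ) * A)
        (Unitary.star_mem U.2)).trans (CStarRing.norm_mem_unitary_mul A U.2)

section Averaging

variable {n : ℕ} {X : Type*} [TopologicalSpace X] [MulAction (PU n) X]
  [ContinuousSMul (PU n) X]

/-- The translate `x ↦ U.F(U⁻¹.x)` of `F ∈ C₀(X, M_n)`. -/
noncomputable def conjTranslate (U : Matrix.unitaryGroup (Fin n) ℂ) :
    C₀(X, Matrix (Fin n) (Fin n) ℂ) →L[ℂ] C₀(X, Matrix (Fin n) (Fin n) ℂ) :=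
  LinearMap.mkContinuous
    { toFun := fun F =>
        ⟨⟨fun x => conjCLM U (F ((QuotientGroup.mk U : PU n)⁻¹ • x)),
          (conjCLM U).continuous.comp (F.continuous.comp (continuous_const_smul _))⟩, by
          have := F.zero_at_infty'.comp (Homeomorph.smul
            ((QuotientGroup.mk U : PU n)⁻¹) (α := X)).isClosedEmbedding.tendsto_cocompact
          have h := ((conjCLM U).continuous.tendsto 0).comp this
          rwa [map_zero] at h⟩
      map_add' := fun F G => by ext1 x; exact map_add (conjCLM U) _ _
      map_smul' := fun c F => by ext1 x; exact map_smul (conjCLM U) _ _ }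
    1 fun F => by
      rw [one_mul]
      refine norm_le_of_forall _ (norm_nonneg _) fun x => ?_
      exact (norm_conjCLM_apply U _).le.trans (norm_apply_le F _)

theorem conjTranslate_apply (U : Matrix.unitaryGroup (Fin n) ℂ)
    (F : C₀(X, Matrix (Fin n) (Fin n) ℂ)) (x : X) :
    conjTranslate U F x = (QuotientGroup.mk U : PU n) • F ((QuotientGroup.mk U : PU n)⁻¹ • x) := rfl

theorem norm_conjTranslate_apply_le (U : Matrix.unitaryGroup (Fin n) ℂ)
    (F : C₀(X, Matrix (Fin n) (Fin n) ℂ)) (x : X) :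
    ‖conjTranslate U F x‖ ≤ ‖F ((QuotientGroup.mk U : PU n)⁻¹ • x)‖ :=
  (norm_conjCLM_apply U _).le

theorem norm_conjTranslate_le (U : Matrix.unitaryGroup (Fin n) ℂ)
    (F : C₀(X, Matrix (Fin n) (Fin n) ℂ)) : ‖conjTranslate U F‖ ≤ ‖F‖ :=
  norm_le_of_forall _ (norm_nonneg _) fun x =>
    (norm_conjTranslate_apply_le U F x).trans (norm_apply_le F _)

theorem conjTranslate_mul (U V : Matrix.unitaryGroup (Fin n) ℂ)
    (F : C₀(X, Matrix (Fin n) (Fin n) ℂ)) :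
    conjTranslate (U * V) F = conjTranslate U (conjTranslate V F) := by
  ext1 x
  simp only [conjTranslate_apply, QuotientGroup.mk_mul, mul_smul, mul_inv_rev]

/-- Passing to representatives in `U(n)` turns equivariance into a fixed-point condition, which Haar
invariance can verify. -/
theorem mem_CStar_iff (F : C₀(X, Matrix (Fin n) (Fin n) ℂ)) :
    F ∈ CStar n X ↔ ∀ U, conjTranslate U F = F := by
  constructor
  · intro h U
    ext1 x
    rw [conjTranslate_apply]
    have := h (QuotientGroup.mk U : PU n) ((QuotientGroup.mk U : PU n)⁻¹ • x)
    rw [← this, smul_inv_smul]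
  · intro h u x
    induction u using QuotientGroup.induction_on with
    | H U =>
      have := DFunLike.congr_fun (h U) ((QuotientGroup.mk U : PU n) • x)
      rw [conjTranslate_apply, inv_smul_smul] at this
      exact this.symm

/-- Sup-norm continuity of the orbit makes the average a Bochner integral in `C₀(X, M_n)`. -/
theorem continuous_conjTranslate (F : C₀(X, Matrix (Fin n) (Fin n) ℂ)) :
    Continuous fun U => conjTranslate U F := by
  have hmk : Continuous fun U : Matrix.unitaryGroup (Fin n) ℂ => (QuotientGroup.mk U : PU n) :=
    QuotientGroup.continuous_mk
  have hval : Continuous fun U : Matrix.unitaryGroup (Fin n) ℂ =>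
      (U : Matrix (Fin n) (Fin n) ℂ) := continuous_subtype_val
  have hjoint : Continuous fun p : Matrix.unitaryGroup (Fin n) ℂ × X => conjTranslate p.1 F p.2 := by
    have hF : Continuous fun p : Matrix.unitaryGroup (Fin n) ℂ × X =>
        F ((QuotientGroup.mk p.1 : PU n)⁻¹ • p.2) :=
      F.continuous.comp ((hmk.comp continuous_fst).inv.smul continuous_snd)
    exact ((hval.comp continuous_fst).mul hF).mul (hval.comp continuous_fst).star
  rw [continuous_iff_continuousAt]
  intro U₀
  rw [ContinuousAt, Metric.tendsto_nhds]
  intro ε hε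
  have hsmall : ∀ᶠ x in Filter.cocompact X, ‖F x‖ < ε / 4 := by
    have := F.zero_at_infty'.norm
    rw [norm_zero] at this
    exact this.eventually (gt_mem_nhds (by positivity))
  obtain ⟨K, hK, hKs⟩ := Filter.mem_cocompact.1 hsmall
  -- The orbit of `K` under the compact group is compact, and off it every translate of `F` is below
  -- `ε / 4` simultaneously.
  let K' : Set X := (fun p : Matrix.unitaryGroup (Fin n) ℂ × X =>
    (QuotientGroup.mk p.1 : PU n) • p.2) '' (Set.univ ×ˢ K)
  have hK' : IsCompact K' := (isCompact_univ.prod hK).image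
    ((hmk.comp continuous_fst).smul continuous_snd)
  have hoff : ∀ x ∉ K', ∀ U : Matrix.unitaryGroup (Fin n) ℂ, ‖conjTranslate U F x‖ < ε / 4 := by
    intro x hx U
    refine (norm_conjTranslate_apply_le U F x).trans_lt (hKs fun hxK => hx ?_)
    exact ⟨(U, _), ⟨Set.mem_univ _, hxK⟩, smul_inv_smul _ _⟩
  -- On `K'`, joint continuity and compactness give uniform closeness, as in the tube lemma.
  have hev : ∀ᶠ U in 𝓝 U₀, ∀ x ∈ K', dist (conjTranslate U F x) (conjTranslate U₀ F x) < ε / 2 := by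
    refine hK'.eventually_forall_of_forall_eventually fun y _ => ?_
    have hc : Continuous fun p : Matrix.unitaryGroup (Fin n) ℂ × X =>
        dist (conjTranslate p.1 F p.2) (conjTranslate U₀ F p.2) :=
      hjoint.dist ((conjTranslate U₀ F).continuous.comp continuous_snd)
    refine hc.continuousAt.eventually (gt_mem_nhds ?_)
    exact (dist_self _).trans_lt (half_pos hε)
  filter_upwards [hev] with U hU
  rw [dist_eq_norm]
  refine (norm_le_of_forall _ (half_pos hε).le fun x => ?_).trans_lt (half_lt_self hε)
  by_cases hx : x ∈ K'
  · rw [ZeroAtInftyContinuousMap.sub_apply, ← dist_eq_norm]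
    exact (hU x hx).le
  · rw [ZeroAtInftyContinuousMap.sub_apply]
    refine (norm_sub_le _ _).trans ?_
    linarith [hoff x hx U, hoff x hx U₀]

theorem integrable_conjTranslate (F : C₀(X, Matrix (Fin n) (Fin n) ℂ)) :
    Integrable (fun U => conjTranslate U F) (haarProb n) :=
  (continuous_conjTranslate F).integrable_of_hasCompactSupport (HasCompactSupport.of_compactSpace _)

/-- Averaging over the unitary group. -/
noncomputable def average :
    C₀(X, Matrix (Fin n) (Fin n) ℂ) →L[ℂ] C₀(X, Matrix (Fin n) (Fin n) ℂ) :=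
  LinearMap.mkContinuous
    { toFun := fun F => ∫ U, conjTranslate U F ∂(haarProb n)
      map_add' := fun F G => by
        simp only [map_add]
        exact integral_add (integrable_conjTranslate F) (integrable_conjTranslate G)
      map_smul' := fun c F => by
        simp only [map_smul]
        exact integral_smul c _ }
    1 fun F => by
      have := norm_integral_le_of_norm_le_const (μ := haarProb n)
        (Filter.Eventually.of_forall fun U => norm_conjTranslate_le U F)
      simpa using this

theorem average_apply (F : C₀(X, Matrix (Fin n) (Fin n) ℂ)) :
    average F = ∫ U, conjTranslate U F ∂(haarProb n) := rfl

theorem average_mem (F : C₀(X, Matrix (Fin n) (Fin n) ℂ)) : average F ∈ CStar n X := by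
  rw [mem_CStar_iff]
  intro V
  rw [average_apply, ← (conjTranslate V).integral_comp_comm (integrable_conjTranslate F)]
  simp only [← conjTranslate_mul]
  exact integral_mul_left_eq_self (fun U => conjTranslate U F) V

/-- Right invariance is used here, left invariance in `average_mem`; this one makes `φ ∘ average` an
invariant functional. -/
theorem average_conjTranslate (V : Matrix.unitaryGroup (Fin n) ℂ)
    (F : C₀(X, Matrix (Fin n) (Fin n) ℂ)) : average (conjTranslate V F) = average F := by
  rw [average_apply, average_apply]
  simp only [← conjTranslate_mul]
  exact integral_mul_right_eq_self (fun U => conjTranslate U F) V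

theorem average_of_mem {F : C₀(X, Matrix (Fin n) (Fin n) ℂ)} (hF : F ∈ CStar n X) :
    average F = F := by
  rw [average_apply]
  simp only [(mem_CStar_iff F).1 hF]
  simp

/-- An invariant continuous functional factors through averaging. -/
theorem apply_average (T : C₀(X, Matrix (Fin n) (Fin n) ℂ) →L[ℂ] ℂ)
    (hT : ∀ U F, T (conjTranslate U F) = T F) (F : C₀(X, Matrix (Fin n) (Fin n) ℂ)) :
    T (average F) = T F := by
  rw [average_apply, ← T.integral_comp_comm (integrable_conjTranslate F)]
  simp [hT]

end Averaging

/-! ### Matrices of measures and their duality with `C₀(X, M_n)`. -/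

section MatrixMeasure

variable {n : ℕ}

section ConjMeasure

variable {X : Type*} [MeasurableSpace X] [MulAction (PU n) X]

/-- The matrix of measures `A ↦ U μ(U⁻¹.A) U*`. -/
noncomputable def conjMeasure (U : Matrix.unitaryGroup (Fin n) ℂ)
    (μ : Matrix (Fin n) (Fin n) (ComplexMeasure X)) :
    Matrix (Fin n) (Fin n) (ComplexMeasure X) :=
  Matrix.of fun j k => ∑ a, ∑ b,
    ((U : Matrix (Fin n) (Fin n) ℂ) j a * star ((U : Matrix (Fin n) (Fin n) ℂ) k b)) •
      (μ a b).map fun x => (QuotientGroup.mk U : PU n) • x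

theorem conjMeasure_apply (U : Matrix.unitaryGroup (Fin n) ℂ)
    (μ : Matrix (Fin n) (Fin n) (ComplexMeasure X)) (j k : Fin n) :
    conjMeasure U μ j k = ∑ a, ∑ b,
    ((U : Matrix (Fin n) (Fin n) ℂ) j a * star ((U : Matrix (Fin n) (Fin n) ℂ) k b)) •
      (μ a b).map fun x => (QuotientGroup.mk U : PU n) • x := rfl

end ConjMeasure

/-- The `(j, k)` entry of a matrix, as a continuous linear map. -/
noncomputable def entryCLM (j k : Fin n) : Matrix (Fin n) (Fin n) ℂ →L[ℂ] ℂ :=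
  LinearMap.toContinuousLinearMap (Matrix.entryLinearMap ℂ ℂ j k)

@[simp] theorem entryCLM_apply (j k : Fin n) (A : Matrix (Fin n) (Fin n) ℂ) :
    entryCLM j k A = A j k := rfl

/-- The matrix with a single nonzero entry, as a continuous linear map of this entry. -/
noncomputable def singleCLM (j k : Fin n) : ℂ →L[ℂ] Matrix (Fin n) (Fin n) ℂ :=
  LinearMap.toContinuousLinearMap (Matrix.singleLinearMap ℂ j k)

@[simp] theorem singleCLM_apply (j k : Fin n) (c : ℂ) :
    singleCLM j k c = Matrix.single j k c := rfl

variable {X : Type*} [TopologicalSpace X]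

theorem sum_single_entry (F : C₀(X, Matrix (Fin n) (Fin n) ℂ)) :
    F = ∑ j, ∑ k, postcomp (singleCLM j k) (postcomp (entryCLM j k) F) := by
  ext1 x
  have hev : ∀ G : C₀(X, Matrix (Fin n) (Fin n) ℂ), G x =
      (⟨⟨fun G => G x, rfl⟩, fun _ _ => rfl⟩ : C₀(X, Matrix (Fin n) (Fin n) ℂ) →+ _) G :=
    fun _ => rfl
  rw [hev (∑ j, _)]
  simp only [map_sum]
  exact Matrix.matrix_eq_sum_single (F x)

variable [MeasurableSpace X] [BorelSpace X]

/-- Integration against a matrix of complex measures, as a functional on `C₀(X, M_n)`. -/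
noncomputable def integralCLM (μ : Matrix (Fin n) (Fin n) (ComplexMeasure X)) :
    C₀(X, Matrix (Fin n) (Fin n) ℂ) →L[ℂ] ℂ :=
  ∑ j, ∑ k, (cintegralCLM (μ k j)).comp (postcomp (entryCLM j k))

theorem integralCLM_apply (μ : Matrix (Fin n) (Fin n) (ComplexMeasure X))
    (F : C₀(X, Matrix (Fin n) (Fin n) ℂ)) : integralCLM μ F = integral F μ := by
  simp only [integralCLM, sum_apply]
  rfl

/-- The indices are transposed because the pairing is the trace of `F dμ`. Isolating one entry
reduces uniqueness to the scalar case. -/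
theorem integralCLM_single (μ : Matrix (Fin n) (Fin n) (ComplexMeasure X)) (j k : Fin n)
    (f : C₀(X, ℂ)) : integralCLM μ (postcomp (singleCLM j k) f) = cintegral f (μ k j) := by
  have hent : ∀ a b, postcomp (entryCLM a b) (postcomp (singleCLM j k) f) =
      if j = a ∧ k = b then f else 0 := by
    intro a b
    ext x
    split_ifs with h <;> simp [h]
  simp only [integralCLM, sum_apply, ContinuousLinearMap.comp_apply, hent,
    apply_ite (cintegralCLM _), map_zero, cintegralCLM_apply]
  rw [Finset.sum_eq_single j, Finset.sum_eq_single k]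
  · simp
  · intro b _ hb
    simp [hb.symm]
  · simp
  · intro a _ ha
    simp [ha.symm]
  · simp

/-- A matrix of regular complex measures is determined by its functional on `C₀(X, M_n)`. -/
theorem ext_of_integralCLM_eq [T2Space X] [LocallyCompactSpace X]
    {μ ν : Matrix (Fin n) (Fin n) (ComplexMeasure X)}
    (hμ : ∀ j k, (μ j k).variation.Regular) (hν : ∀ j k, (ν j k).variation.Regular)
    (h : ∀ F, integralCLM μ F = integralCLM ν F) : μ = ν := by
  ext1 j k
  refine ext_of_cintegral_eq (hμ j k) (hν j k) fun f => ?_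
  rw [← integralCLM_single μ k j f, ← integralCLM_single ν k j f, h]

variable [MulAction (PU n) X] [ContinuousSMul (PU n) X]

theorem evalMatrix_conjMeasure (U : Matrix.unitaryGroup (Fin n) ℂ)
    (μ : Matrix (Fin n) (Fin n) (ComplexMeasure X)) {A : Set X} (hA : MeasurableSet A) :
    evalMatrix (conjMeasure U μ) A = (QuotientGroup.mk U : PU n) •
      evalMatrix μ ((fun x => (QuotientGroup.mk U : PU n) • x) ⁻¹' A) := by
  have hmeas : Measurable fun x : X => (QuotientGroup.mk U : PU n) • x :=
    (continuous_const_smul _).measurable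
  ext j k
  rw [mk_smul, Matrix.mul_apply]
  simp only [Matrix.mul_apply, Finset.sum_mul]
  rw [Finset.sum_comm]
  simp only [evalMatrix, Matrix.of_apply, conjMeasure_apply, finsetSum_measure_apply,
    FunLike.coe_smul, Pi.smul_apply, smul_eq_mul, VectorMeasure.map_apply _ hmeas hA,
    Matrix.star_apply]
  refine Finset.sum_congr rfl fun a _ => Finset.sum_congr rfl fun b _ => ?_
  ring

theorem equivariant_iff (μ : Matrix (Fin n) (Fin n) (ComplexMeasure X)) :
    (∀ (u : PU n) (A : Set X), MeasurableSet A →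
      evalMatrix μ ((fun x => u • x) '' A) = u • evalMatrix μ A) ↔
    ∀ U, conjMeasure U μ = μ := by
  constructor
  · intro h U
    ext1 j k
    refine VectorMeasure.ext fun A hA => ?_
    have hA' : MeasurableSet ((fun x => (QuotientGroup.mk U : PU n) • x) ⁻¹' A) :=
      (continuous_const_smul (QuotientGroup.mk U : PU n)).measurable hA
    have h1 := h (QuotientGroup.mk U) _ hA'
    rw [← evalMatrix_conjMeasure U μ hA,
      Set.image_preimage_eq _ (MulAction.surjective _)] at h1
    exact (congrFun (congrFun h1 j) k).symm
  · intro h u A hA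
    induction u using QuotientGroup.induction_on with
    | H U =>
      have hA' : MeasurableSet ((fun x => (QuotientGroup.mk U : PU n) • x) '' A) :=
        (Homeomorph.smul (QuotientGroup.mk U : PU n)).measurableEmbedding.measurableSet_image.2 hA
      have h1 := evalMatrix_conjMeasure U μ hA'
      rwa [h U, Set.preimage_image_eq _ (MulAction.injective _)] at h1

theorem regular_conjMeasure [T2Space X] [LocallyCompactSpace X]
    (U : Matrix.unitaryGroup (Fin n) ℂ) {μ : Matrix (Fin n) (Fin n) (ComplexMeasure X)}
    (hμ : ∀ j k, (μ j k).variation.Regular) (j k : Fin n) :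
    (conjMeasure U μ j k).variation.Regular := by
  rw [conjMeasure_apply]
  exact regular_variation_sum _ fun a => regular_variation_sum _ fun b =>
    regular_variation_smul _ (regular_variation_map
      (Homeomorph.smul (QuotientGroup.mk U : PU n)) (hμ a b))

/-- Cyclicity of the trace, `tr(F U μ U*) = tr(U* F U μ)`, together with the change of variables `x
↦ U.x`. -/
theorem integralCLM_conjMeasure (U : Matrix.unitaryGroup (Fin n) ℂ)
    (μ : Matrix (Fin n) (Fin n) (ComplexMeasure X)) (F : C₀(X, Matrix (Fin n) (Fin n) ℂ)) :
    integralCLM (conjMeasure U μ) F = integralCLM μ (conjTranslate U⁻¹ F) := by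
  let g : X ≃ₜ X := Homeomorph.smul (QuotientGroup.mk U : PU n)
  let f : Fin n → Fin n → C₀(X, ℂ) := fun j k =>
    ⟨⟨fun x => F (g x) j k, by
        exact (entryCLM j k).continuous.comp (F.continuous.comp g.continuous)⟩, by
      have := F.zero_at_infty'.comp g.isClosedEmbedding.tendsto_cocompact
      have h := ((entryCLM j k).continuous.tendsto 0).comp this
      rwa [map_zero] at h⟩
  let V : Matrix (Fin n) (Fin n) ℂ := U
  have hl : ∀ j k, cintegral (fun x => F x j k) (conjMeasure U μ k j) =
      ∑ a, ∑ b, (V k a * star (V j b)) * cintegral (f j k) (μ a b) := by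
    intro j k
    have hint : ∀ ν : ComplexMeasure X, ν.Integrable fun x => F x j k :=
      fun ν => integrable_zeroAtInfty (postcomp (entryCLM j k) F) _
    rw [conjMeasure_apply, cintegral, VectorMeasure.integral_finsetSum_vectorMeasure
      fun a _ => hint _]
    refine Finset.sum_congr rfl fun a _ => ?_
    rw [VectorMeasure.integral_finsetSum_vectorMeasure fun b _ => hint _]
    refine Finset.sum_congr rfl fun b _ => ?_
    refine (cintegral_smul_measure _ _ _).trans ?_
    congr 1
    exact g.measurableEmbedding.integral_map_vectorMeasure
  have hr : ∀ b a, postcomp (entryCLM b a) (conjTranslate U⁻¹ F) =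
      ∑ k, ∑ j, (V k a * star (V j b)) • f j k := by
    intro b a
    ext x
    have hev : ∀ G : C₀(X, ℂ), G x =
        (⟨⟨fun G => G x, rfl⟩, fun _ _ => rfl⟩ : C₀(X, ℂ) →+ ℂ) G := fun _ => rfl
    rw [hev (∑ j, _)]
    simp only [map_sum]
    have e1 : conjTranslate U⁻¹ F x = star V * F (g x) * V := by
      rw [conjTranslate_apply, mk_smul, QuotientGroup.mk_inv, inv_inv,
        Matrix.UnitaryGroup.inv_val, star_star]
      rfl
    rw [postcomp_apply, e1, entryCLM_apply, Matrix.mul_apply]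
    refine Finset.sum_congr rfl fun k _ => ?_
    rw [Matrix.mul_apply, Finset.sum_mul]
    refine Finset.sum_congr rfl fun j _ => ?_
    change star V b j * F (g x) j k * V k a = V k a * star (V j b) * F (g x) j k
    rw [Matrix.star_apply]
    ring
  rw [integralCLM_apply, integral]
  simp only [integralCLM, sum_apply, ContinuousLinearMap.comp_apply, hr,
    map_sum, map_smul, cintegralCLM_apply, smul_eq_mul]
  refine (Finset.sum_congr rfl fun j _ => Finset.sum_congr rfl fun k _ => hl j k).trans ?_
  -- Only the order of summation changes: `b`, `a` must come first, since entry `(b, a)` of the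
  -- translate pairs with `μ a b`.
  calc ∑ j, ∑ k, ∑ a, ∑ b, V k a * star (V j b) * cintegral (f j k) (μ a b)
      = ∑ j, ∑ a, ∑ k, ∑ b, V k a * star (V j b) * cintegral (f j k) (μ a b) :=
        Finset.sum_congr rfl fun j _ => Finset.sum_comm
    _ = ∑ j, ∑ a, ∑ b, ∑ k, V k a * star (V j b) * cintegral (f j k) (μ a b) :=
        Finset.sum_congr rfl fun j _ => Finset.sum_congr rfl fun a _ => Finset.sum_comm
    _ = ∑ a, ∑ j, ∑ b, ∑ k, V k a * star (V j b) * cintegral (f j k) (μ a b) :=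
        Finset.sum_comm
    _ = ∑ a, ∑ b, ∑ j, ∑ k, V k a * star (V j b) * cintegral (f j k) (μ a b) :=
        Finset.sum_congr rfl fun a _ => Finset.sum_comm
    _ = ∑ b, ∑ a, ∑ j, ∑ k, V k a * star (V j b) * cintegral (f j k) (μ a b) :=
        Finset.sum_comm
    _ = _ := Finset.sum_congr rfl fun b _ => Finset.sum_congr rfl fun a _ => Finset.sum_comm

end MatrixMeasure

end NSpace

/-! ### Existence and uniqueness of the representing `n`-measure. -/

open NSpace RieszC0 ComplexMeasureIntegral in
theorem mainTheorem6 (n : ℕ) (hn : 1 ≤ n) (X : Type*) [TopologicalSpace X] [T2Space X]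
    [LocallyCompactSpace X] [MeasurableSpace X] [BorelSpace X]
    [MulAction (NSpace.PU n) X] [ContinuousSMul (NSpace.PU n) X]
    (hfree : ∀ (u : NSpace.PU n) (x : X), u • x = x → u = 1)
    (φ : NSpace.CStar n X →L[ℂ] ℂ) :
    ∃! μ : Matrix (Fin n) (Fin n) (ComplexMeasure X),
      NSpace.IsNMeasure μ ∧
        ∀ f : NSpace.CStar n X,
          φ f = NSpace.integral (f : C₀(X, Matrix (Fin n) (Fin n) ℂ)) μ := by
  let S : Submodule ℂ C₀(X, Matrix (Fin n) (Fin n) ℂ) := (CStar n X).toSubmodule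
  let E : C₀(X, Matrix (Fin n) (Fin n) ℂ) →L[ℂ] S := average.codRestrict S average_mem
  let ψ : C₀(X, Matrix (Fin n) (Fin n) ℂ) →L[ℂ] ℂ :=
    ContinuousLinearMap.comp (show S →L[ℂ] ℂ from φ) E
  have hψ : ∀ F, ψ F = φ ⟨average F, average_mem F⟩ := fun _ => rfl
  -- The matrix unit at `(k, j)` detects `μ j k`, by the trace convention.
  choose m hm hmψ using fun j k : Fin n =>
    exists_complex (ψ.comp (postcomp (singleCLM k j)))
  let μ : Matrix (Fin n) (Fin n) (ComplexMeasure X) := Matrix.of m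
  have hμreg : ∀ j k, (μ j k).variation.Regular := hm
  have hμψ : ∀ F, integralCLM μ F = ψ F := by
    intro F
    conv_rhs => rw [sum_single_entry F]
    simp only [map_sum]
    rw [integralCLM_apply]
    exact Finset.sum_congr rfl fun j _ => Finset.sum_congr rfl fun k _ =>
      (hmψ k j (postcomp (entryCLM j k) F)).symm
  refine ⟨μ, ⟨⟨hμreg, ?_⟩, ?_⟩, ?_⟩
  · rw [equivariant_iff]
    intro U
    refine ext_of_integralCLM_eq (regular_conjMeasure U hμreg) hμreg fun F => ?_
    rw [integralCLM_conjMeasure, hμψ, hμψ, hψ, hψ]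
    congr 2
    exact average_conjTranslate _ F
  · intro f
    rw [← integralCLM_apply, hμψ, hψ]
    congr 1
    exact Subtype.ext (average_of_mem f.2).symm
  · rintro ν ⟨⟨hνreg, hνeq⟩, hνφ⟩
    rw [equivariant_iff] at hνeq
    refine ext_of_integralCLM_eq hνreg hμreg fun F => ?_
    -- Equivariance of `ν` makes its functional invariant, so its values on `C*(X,.)`, where it is
    -- `φ`, determine it everywhere.
    have hinv : ∀ U F, integralCLM ν (conjTranslate U F) = integralCLM ν F := by
      intro U F
      have := integralCLM_conjMeasure U⁻¹ ν F
      rw [hνeq, inv_inv] at this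
      exact this.symm
    rw [← apply_average _ hinv, hμψ, hψ, hνφ, integralCLM_apply]
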